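/- Let $\mathbf{k}$ be a field and let $(X,d)$ be a geodesic metric space that is $\delta$-hyperbolic in the following sense: for all $x,y,z\in X$ and all minimising geodesics $[y,z],[z,x],[x,y]$ of lengths $a,b,c$, put $\alpha=\tfrac12(b+c-a)$, $\beta=\tfrac12(c+a-b)$, $\gamma=\tfrac12(a+b-c)$ and let $[u,v]_t$ denote the point at distance $t$ from $u$ along the chosen geodesic between $u$ and $v$ (so $[u,v]_t=[v,u]_{d(u,v)-t}$); then $d([x,y]_t,[x,z]_t)\le\delta$ for $0\le t\le\alpha$, $d([y,z]_t,[y,x]_t)\le\delta$ for $0\le t\le\beta$, and $d([z,x]_t,[z,y]_t)\le\delta$ for $0\le t\le\gamma$. For $t\in\mathbb{R}$ let $\mathrm{Rips}(X,t)$ be the simplicial complex with vertex set $X$ in which a nonempty finite set is a simplex iff its distinct points are pairwise at distance at most $t$. Let $V_t=H_2(\mathrm{Rips}(X,t);\mathbf{k})$ (simplicial homology), with the maps induced by inclusions; this persistence module over $\mathbb{R}$ is $H_2(\mathbb{R}\mathrm{ips}(X))$. Put $V_{-\infty}=V_{+\infty}=0$. For a rectangle $R=[p,q]\times[r,s]$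 with $-\infty\le p<q\le r<s\le+\infty$ let $$\mu(R)=\dim\frac{\operatorname{im}(V_q\to V_r)\cap\ker(V_r\to V_s)}{\operatorname{im}(V_p\to V_r)\cap\ker(V_r\to V_s)}\in\{0,1,2,\dots\}\cup\{\infty\}$$ be its persistence measure, that is, the multiplicity in $V_p\to V_q\to V_r\to V_s$ of the interval module supported on $\{q,r\}$. A decorated point is a pair $(p^*,q^*)$ of extended real numbers, each carrying a sign $+$ or $-$. It lies in $[a,b]\times[c,d]$ if $p^*$ lies in $[a,b]$ and $q^*$ lies in $[c,d]$, where $t^+$ lies in $[a,b]$ iff $a\le t<b$, and $t^-$ lies in $[a,b]$ iff $a<t\le b$. The persistence diagram is defined at those decorated points that lie in some rectangle of finite measure. There it is a multiset of decorated points such that every rectangle $R$ of finite measure contains exactly $\mu(R)$ points of it, counted with multiplicity; in the measure-theoretic construction the multiplicity of a decorated point at which the diagram is defined is the minimum of $\mu(R)$ over all rectangles $R$ containing that point. Then the persistence diagram of $H_2(\mathbb{R}\mathrm{ips}(X))$ is confined to the vertical strip $S=[0,2\delta]\times[0,+\infty)$. Explicitly: (1) $\mu(R)=0$ for every rectangle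 $R=[p,q]\times[r,s]$ with $-\infty\le p<q\le r<s\le+\infty$ that does not meet $S$. (2) Every decorated point of the persistence diagram, constructed as the multiset with the minimum multiplicities above, has its underlying point $(p,q)$ in $S$. (3) For every multiset of decorated points that has the counting property above and consists of points at which the diagram is defined, all its underlying points lie in $S$. -/

import Mathlib

universe u v w

noncomputable section

/-! ### Subquotients -/

/-- The subquotient `Z / (Z ∩ B)` of a module, for submodules `Z` and `B` (usually `B ≤ Z`). -/
def Subquotient {k : Type v} [Ring k] {M : Type w} [AddCommGroup M] [Module k M]
    (Z B : Submodule k M) : Type w :=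
  ↥Z ⧸ B.submoduleOf Z

namespace Subquotient

variable {k : Type v} [Ring k] {M : Type w} [AddCommGroup M] [Module k M]

instance (Z B : Submodule k M) : AddCommGroup (Subquotient Z B) :=
  inferInstanceAs (AddCommGroup (↥Z ⧸ B.submoduleOf Z))

instance (Z B : Submodule k M) : Module k (Subquotient Z B) :=
  inferInstanceAs (Module k (↥Z ⧸ B.submoduleOf Z))

/-- The class of an element of `Z`. -/
def mk (Z B : Submodule k M) : ↥Z →ₗ[k] Subquotient Z B :=
  (B.submoduleOf Z).mkQ

theorem mk_surjective (Z B : Submodule k M) : Function.Surjective (mk Z B) :=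
  Submodule.mkQ_surjective _

theorem mk_eq_zero {Z B : Submodule k M} (z : ↥Z) : mk Z B z = 0 ↔ (z : M) ∈ B :=
  Submodule.Quotient.mk_eq_zero _

/-- The map of subquotients induced by inclusions `Z ≤ Z'` and `B ≤ B'`. -/
def map {Z Z' B B' : Submodule k M} (hZ : Z ≤ Z') (hB : B ≤ B') :
    Subquotient Z B →ₗ[k] Subquotient Z' B' :=
  Submodule.mapQ _ _ (Submodule.inclusion hZ) fun _ hx => hB hx

theorem map_mk {Z Z' B B' : Submodule k M} (hZ : Z ≤ Z') (hB : B ≤ B') (z : ↥Z) :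
    map hZ hB (mk Z B z) = mk Z' B' (Submodule.inclusion hZ z) :=
  rfl

theorem map_id {Z B : Submodule k M} (hZ : Z ≤ Z) (hB : B ≤ B) :
    map hZ hB = LinearMap.id := by
  ext y
  obtain ⟨z, rfl⟩ := mk_surjective Z B y
  rfl

theorem map_comp {Z Z' Z'' B B' B'' : Submodule k M} (hZ : Z ≤ Z') (hB : B ≤ B')
    (hZ' : Z' ≤ Z'') (hB' : B' ≤ B'') :
    map hZ' hB' ∘ₗ map hZ hB = map (hZ.trans hZ') (hB.trans hB') := by
  ext y
  obtain ⟨z, rfl⟩ := mk_surjective Z B y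
  rfl

end Subquotient

/-! ### Ordered simplicial chains and simplicial homology -/

namespace SimplicialHomology

variable (k : Type v) [Field k] {X : Type u}

/-- The boundary of ordered simplices, extended linearly:
`∂(x₀, …, xₙ₊₁) = ∑ᵢ (-1)ⁱ (x₀, …, x̂ᵢ, …, xₙ₊₁)`. -/
def boundary (n : ℕ) : ((Fin (n + 2) → X) →₀ k) →ₗ[k] ((Fin (n + 1) → X) →₀ k) :=
  Finsupp.linearCombination k fun x : Fin (n + 2) → X =>
    ∑ i : Fin (n + 2), Finsupp.single (x ∘ i.succAbove) ((-1 : k) ^ (i : ℕ))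

open scoped Classical in
/-- The ordered `n`-chains of the simplicial complex `K` with coefficients in `k`: finite linear
combinations of the tuples `(x₀, …, xₙ)` (repetitions allowed) whose entries span a simplex
of `K`. -/
def chains (K : AbstractSimplicialComplex X) (n : ℕ) : Submodule k ((Fin (n + 1) → X) →₀ k) :=
  Finsupp.supported k k {x | Finset.univ.image x ∈ K.faces}

/-- The `n`-cycles of `K`; every `0`-chain is a cycle. -/
def cycles (K : AbstractSimplicialComplex X) : (n : ℕ) → Submodule k ((Fin (n + 1) → X) →₀ k)
  | 0 => chains k K 0
  | n + 1 => chains k K (n + 1) ⊓ LinearMap.ker (boundary k n)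

/-- The `n`-boundaries of `K`. -/
def boundaries (K : AbstractSimplicialComplex X) (n : ℕ) :
    Submodule k ((Fin (n + 1) → X) →₀ k) :=
  (chains k K (n + 1)).map (boundary k n)

/-- Simplicial homology `Hₙ(K; k)` (cycles modulo boundaries), computed from the ordered chain
complex of `K`. -/
abbrev Homology (K : AbstractSimplicialComplex X) (n : ℕ) : Type (max u v) :=
  Subquotient (cycles k K n) (boundaries k K n)

variable {K L : AbstractSimplicialComplex X}

theorem chains_mono (h : K.faces ⊆ L.faces) (n : ℕ) : chains k K n ≤ chains k L n :=
  Finsupp.supported_mono fun _ hx => h hx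

theorem cycles_mono (h : K.faces ⊆ L.faces) : (n : ℕ) → cycles k K n ≤ cycles k L n
  | 0 => chains_mono k h 0
  | n + 1 => inf_le_inf_right _ (chains_mono k h (n + 1))

theorem boundaries_mono (h : K.faces ⊆ L.faces) (n : ℕ) :
    boundaries k K n ≤ boundaries k L n :=
  Submodule.map_mono (chains_mono k h (n + 1))

/-- The linear map `Hₙ(K; k) → Hₙ(L; k)` induced by an inclusion `K ⊆ L` of complexes. -/
def homologyMap (h : K.faces ⊆ L.faces) (n : ℕ) : Homology k K n →ₗ[k] Homology k L n :=
  Subquotient.map (cycles_mono k h n) (boundaries_mono k h n)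

end SimplicialHomology

/-! ### Persistence modules -/

/-- A persistence module over `ℝ` with coefficients in the field `k`. -/
structure PersistenceModule (k : Type v) [Field k] where
  /-- the vector space at each index -/
  obj : ℝ → Type w
  [addCommGroup : ∀ a, AddCommGroup (obj a)]
  [module : ∀ a, Module k (obj a)]
  /-- the structure maps -/
  map : ∀ {a b : ℝ}, a ≤ b → (obj a →ₗ[k] obj b)
  map_id : ∀ a : ℝ, map (le_refl a) = LinearMap.id
  map_comp : ∀ {a b c : ℝ} (hab : a ≤ b) (hbc : b ≤ c),
    map hbc ∘ₗ map hab = map (hab.trans hbc)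

attribute [instance] PersistenceModule.addCommGroup PersistenceModule.module

/-- A closed rectangle `[a, b] × [c, d]` in the extended half-plane
`{(p, q) | -∞ ≤ p ≤ q ≤ +∞}`, so `-∞ ≤ a < b ≤ c < d ≤ +∞`; its inner coordinates `b`, `c` are
automatically finite. -/
structure HalfPlaneRect where
  a : EReal
  b : ℝ
  c : ℝ
  d : EReal
  a_lt_b : a < b
  b_le_c : b ≤ c
  c_lt_d : (c : EReal) < d

/-- The rectangle as a set of points of the extended plane. -/
def HalfPlaneRect.toSet (R : HalfPlaneRect) : Set (EReal × EReal) :=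
  Set.Icc R.a (R.b : EReal) ×ˢ Set.Icc (R.c : EReal) R.d

/-- A decorated (extended) real number: `t⁺` or `t⁻`. -/
structure DecoratedNumber where
  val : EReal
  plus : Bool

/-- `t⁺` lies in `[a, b]` if `a ≤ t < b`, and `t⁻` lies in `[a, b]` if `a < t ≤ b`. -/
def DecoratedNumber.MemIcc (t : DecoratedNumber) (a b : EReal) : Prop :=
  (t.plus ∧ a ≤ t.val ∧ t.val < b) ∨ (¬ t.plus ∧ a < t.val ∧ t.val ≤ b)

/-- A decorated point `(p*, q*)` of the extended plane. -/
structure DecoratedPoint where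
  birth : DecoratedNumber
  death : DecoratedNumber

namespace DecoratedPoint

/-- The point `(p, q)` underlying the decorated point `(p*, q*)`. -/
def toPoint (P : DecoratedPoint) : EReal × EReal := (P.birth.val, P.death.val)

/-- The decorated point `(p*, q*)` lies in the rectangle `[a, b] × [c, d]`. -/
def MemRect (P : DecoratedPoint) (R : HalfPlaneRect) : Prop :=
  P.birth.MemIcc R.a R.b ∧ P.death.MemIcc R.c R.d

end DecoratedPoint

namespace PersistenceModule

variable {k : Type v} [Field k] (V : PersistenceModule.{v, w} k)

/-- The image of `V_a → V_c` in `V_c`, for `-∞ ≤ a ≤ c`, where `V_{-∞} = 0`. (For real `a ≤ c` the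
supremum has a single term, the range of the structure map; for `a = -∞` it is empty.) -/
def imageAt (a : EReal) (c : ℝ) : Submodule k (V.obj c) :=
  ⨆ (x : ℝ) (_ : (x : EReal) = a) (h : x ≤ c), LinearMap.range (V.map h)

/-- The kernel of `V_c → V_d` in `V_c`, for `c ≤ d ≤ +∞`, where `V_{+∞} = 0`. (For real `d ≥ c` the
infimum has a single term, the kernel of the structure map; for `d = +∞` it is empty.) -/
def kernelAt (c : ℝ) (d : EReal) : Submodule k (V.obj c) :=
  ⨅ (x : ℝ) (_ : (x : EReal) = d) (h : c ≤ x), LinearMap.ker (V.map h)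

/-- The persistence measure of `V`: `μ([a, b] × [c, d])` is the number (possibly `∞`) of independent
classes that are alive over `[b, c]`, but neither come from `V_a` nor survive to `V_d`. It is the
multiplicity in `V_a → V_b → V_c → V_d` of the interval module supported on exactly `{b, c}`,
computed as the dimension of
`(im(V_b → V_c) ∩ ker(V_c → V_d)) / (im(V_a → V_c) ∩ ker(V_c → V_d))`. -/
def measure (R : HalfPlaneRect) : ℕ∞ :=
  Cardinal.toENat <| Module.rank k <|
    Subquotient (V.imageAt R.b R.c ⊓ V.kernelAt R.c R.d) (V.imageAt R.a R.c ⊓ V.kernelAt R.c R.d)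

/-- The decorated points at which the persistence diagram of `V` is defined: those that lie in some
rectangle of finite measure. -/
def finiteInterior : Set DecoratedPoint :=
  {P | ∃ R : HalfPlaneRect, P.MemRect R ∧ V.measure R < ⊤}

/-- The decorated persistence diagram of `V`, as a multiset of decorated points given by its
multiplicity function: on the finite interior, the multiplicity of `P` is the minimum of the
measures of the rectangles that contain `P`. Off the finite interior the infimum is `∞` and the
diagram has no points. -/
def diagram (P : DecoratedPoint) : ℕ :=
  (⨅ (R : HalfPlaneRect) (_ : P.MemRect R), V.measure R).toNat

/-- The characterising property of the decorated persistence diagram: `D` is a multiset of decorated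
points of the finite interior such that every rectangle `R` of finite measure contains exactly
`μ(R)` points of `D`, counted with multiplicity. -/
def IsDiagram (D : DecoratedPoint → ℕ) : Prop :=
  (∀ P, D P ≠ 0 → P ∈ V.finiteInterior) ∧
    ∀ R : HalfPlaneRect, V.measure R < ⊤ →
      ENat.card (Σ P : {P : DecoratedPoint // P.MemRect R}, Fin (D P.1)) = V.measure R

end PersistenceModule

/-! ### Vietoris–Rips complexes -/

/-- The Vietoris–Rips complex `Rips(X, a)`: a nonempty finite set is a simplex iff its points are
pairwise at distance at most `a`. For `a ≤ 0` it consists of the vertex set alone. -/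
def ripsComplex (X : Type u) [MetricSpace X] (a : ℝ) : AbstractSimplicialComplex X where
  faces := {σ | σ.Nonempty ∧ (σ : Set X).Pairwise fun x y => dist x y ≤ a}
  isRelLowerSet_faces := fun _ hσ =>
    ⟨hσ.1, fun _ hτσ hτ => ⟨hτ, hσ.2.mono (Finset.coe_subset.2 hτσ)⟩⟩
  singleton_mem := fun x => ⟨Finset.singleton_nonempty x, by simp⟩

theorem ripsComplex_faces_mono (X : Type u) [MetricSpace X] {a b : ℝ} (h : a ≤ b) :
    (ripsComplex X a).faces ⊆ (ripsComplex X b).faces :=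
  fun _ hσ => ⟨hσ.1, hσ.2.mono' fun _ _ hxy => le_trans hxy h⟩

/-- The persistence module `Hₙ(Rips(X); k)`: the homology of the filtered complex
`(Rips(X, a))_a`, with the maps induced by inclusions. -/
def ripsHomology (k : Type v) [Field k] (X : Type u) [MetricSpace X] (n : ℕ) :
    PersistenceModule.{v, max u v} k where
  obj a := SimplicialHomology.Homology k (ripsComplex X a) n
  map h := SimplicialHomology.homologyMap k (ripsComplex_faces_mono X h) n
  map_id _ := Subquotient.map_id _ _
  map_comp _ _ := Subquotient.map_comp _ _ _ _

/-! ### Geodesic and hyperbolic spaces -/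

/-- `f` restricted to `[0, d(x, y)]` is a minimising geodesic from `x` to `y`, parametrised by
distance from `x`. (Values of `f` outside `[0, d(x, y)]` are irrelevant.) -/
def IsMinGeodesic {X : Type u} [MetricSpace X] (f : ℝ → X) (x y : X) : Prop :=
  f 0 = x ∧ f (dist x y) = y ∧
    ∀ s ∈ Set.Icc 0 (dist x y), ∀ t ∈ Set.Icc 0 (dist x y), dist (f s) (f t) = |s - t|

/-- A geodesic space: any two points are joined by a minimising geodesic. -/
def IsGeodesicSpace (X : Type u) [MetricSpace X] : Prop :=
  ∀ x y : X, ∃ f : ℝ → X, IsMinGeodesic f x y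

/-- The `δ`-hyperbolicity condition for every geodesic triangle. Here `f`, `g`, `h` are the sides
`[x, y]`, `[y, z]`, `[z, x]`; the side lengths are `a = d(y, z)`, `b = d(z, x)`, `c = d(x, y)`; the
bounds on `t` are `α = (b + c - a) / 2`, `β = (c + a - b) / 2`, `γ = (a + b - c) / 2`; and the
reverse of a side of length `l` is `t ↦ side (l - t)`. -/
def IsDeltaHyperbolic (δ : ℝ) (X : Type u) [MetricSpace X] : Prop :=
  ∀ (x y z : X) (f g h : ℝ → X),
    IsMinGeodesic f x y → IsMinGeodesic g y z → IsMinGeodesic h z x →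
    (∀ t : ℝ, 0 ≤ t → t ≤ (dist z x + dist x y - dist y z) / 2 →
      dist (f t) (h (dist z x - t)) ≤ δ) ∧
    (∀ t : ℝ, 0 ≤ t → t ≤ (dist x y + dist y z - dist z x) / 2 →
      dist (g t) (f (dist x y - t)) ≤ δ) ∧
    (∀ t : ℝ, 0 ≤ t → t ≤ (dist y z + dist z x - dist x y) / 2 →
      dist (h t) (g (dist y z - t)) ≤ δ)

/-- The vertical strip `[0, 2δ] × [0, +∞)` in the extended plane. -/
def verticalStrip (δ : ℝ) : Set (EReal × EReal) :=
  Set.Icc 0 ((2 * δ : ℝ) : EReal) ×ˢ Set.Ico 0 ⊤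

end

/-! ### Midpoints in hyperbolic spaces -/

section Midpoints

variable {X : Type u} [MetricSpace X]

/-! The engine is midpoint subdivision. In a triangle with sides at most `L`, hyperbolicity puts the
midpoints of the sides within `L / 2 + δ` of each other, so the four triangles of the subdivision
lie in `Rips(X, L / 2 + δ)`. If `2 * δ ≤ L`, the octahedron formed by the triangle, its subdivision
and the three degenerate-looking triangles over its edges is filled inside `Rips(X, L)`: the one
missing diagonal is short when it starts at the midpoint of the longest side. For a cycle the
triangles over the edges cancel, so it is homologous to its subdivision
(`cycles_ripsComplex_le_half`).

The map `L ↦ L / 2 + δ` halves the excess over `2 * δ`. Iteration pushes any `2`-cycle down to any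
scale `a > 2 * δ` (`cycles_ripsComplex_le`), so `V_a → V_b` is surjective and nothing is born beyond
`2 * δ`. At negative scales there is no `2`-homology (`cycles_ripsComplex_eq_bot`), so nothing is
born before `0`.

Deaths at `+∞` are excluded because every cycle is coned off at a large scale. One class dying is
not enough; finiteness of the measure supplies a common death time modulo `im V_a`
(`exists_measure_eq_zero_of_top`). For the diagram, a point outside the strip is enclosed in a
rectangle of measure zero. -/

theorem IsMinGeodesic.reverse {f : ℝ → X} {x y : X} (hf : IsMinGeodesic f x y) :
    IsMinGeodesic (fun t => f (dist x y - t)) y x := by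
  obtain ⟨h0, h1, h⟩ := hf
  refine ⟨by simpa using h1, by simpa [dist_comm y x] using h0, ?_⟩
  rw [dist_comm y x]
  intro s hs t ht
  rw [h _ ⟨by linarith [hs.2], by linarith [hs.1]⟩ _ ⟨by linarith [ht.2], by linarith [ht.1]⟩,
    abs_sub_comm]
  congr 1
  ring

theorem IsMinGeodesic.dist_left {f : ℝ → X} {x y : X} (hf : IsMinGeodesic f x y) {t : ℝ}
    (h0 : 0 ≤ t) (h1 : t ≤ dist x y) : dist x (f t) = t := by
  have h := hf.2.2 0 ⟨le_rfl, dist_nonneg⟩ t ⟨h0, h1⟩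
  rwa [hf.1, zero_sub, abs_neg, abs_of_nonneg h0] at h

theorem IsDeltaHyperbolic.nonneg {δ : ℝ} (hgeo : IsGeodesicSpace X)
    (hhyp : IsDeltaHyperbolic δ X) (x : X) : 0 ≤ δ := by
  obtain ⟨f, hf⟩ := hgeo x x
  exact dist_nonneg.trans ((hhyp x x x f f f hf hf hf).1 0 le_rfl (by simp))

/-- Two geodesics issuing from the same vertex of a triangle are `δ`-close up to the inner point. -/
theorem IsDeltaHyperbolic.dist_le {δ : ℝ} (hgeo : IsGeodesicSpace X)
    (hhyp : IsDeltaHyperbolic δ X) {x y z : X} {f e : ℝ → X} (hf : IsMinGeodesic f x y)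
    (he : IsMinGeodesic e x z) {t : ℝ} (h0 : 0 ≤ t)
    (ht : t ≤ (dist x y + dist x z - dist y z) / 2) : dist (f t) (e t) ≤ δ := by
  obtain ⟨g, hg⟩ := hgeo y z
  have h := (hhyp x y z f g _ hf hg he.reverse).1 t h0 (by rw [dist_comm z x]; linarith)
  simpa [dist_comm z x] using h

/-- `m` is the midpoint of some minimising geodesic from `x` to `y`. -/
def IsGeodesicMidpoint (m x y : X) : Prop :=
  ∃ f : ℝ → X, IsMinGeodesic f x y ∧ f (dist x y / 2) = m

namespace IsGeodesicMidpoint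

variable {m x y : X}

theorem symm (h : IsGeodesicMidpoint m x y) : IsGeodesicMidpoint m y x := by
  obtain ⟨f, hf, rfl⟩ := h
  refine ⟨_, hf.reverse, ?_⟩
  simp only [dist_comm y x]
  congr 1
  ring

theorem dist_left (h : IsGeodesicMidpoint m x y) : dist x m = dist x y / 2 := by
  obtain ⟨f, hf, rfl⟩ := h
  have := dist_nonneg (x := x) (y := y)
  exact hf.dist_left (by linarith) (by linarith)

theorem dist_right (h : IsGeodesicMidpoint m x y) : dist y m = dist x y / 2 := by
  rw [h.symm.dist_left, dist_comm]

/-- The midpoints of two sides of a triangle with sides at most `L` are `L / 2 + δ`-close. -/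
theorem dist_midpoint_le {δ L : ℝ} (hgeo : IsGeodesicSpace X) (hhyp : IsDeltaHyperbolic δ X)
    {p r x y z : X} (hp : IsGeodesicMidpoint p x y) (hr : IsGeodesicMidpoint r x z)
    (hxy : dist x y ≤ L) (hxz : dist x z ≤ L) (hyz : dist y z ≤ L) :
    dist p r ≤ L / 2 + δ := by
  obtain ⟨f, hf, rfl⟩ := hp
  obtain ⟨e, he, rfl⟩ := hr
  have ha := dist_nonneg (x := y) (y := z)
  have hb := dist_nonneg (x := x) (y := z)
  have hc := dist_nonneg (x := x) (y := y)
  have t1 := dist_triangle y x z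
  have t2 := dist_triangle x y z
  have t3 := dist_triangle x z y
  rw [dist_comm y x] at t1
  rw [dist_comm z y] at t3
  -- Walk from one midpoint to parameter `t`, cross to the other side at cost `δ`, and walk to the
  -- other midpoint.
  have key : ∀ t, 0 ≤ t → t ≤ (dist x y + dist x z - dist y z) / 2 →
      dist (f (dist x y / 2)) (e (dist x z / 2)) ≤
        |dist x y / 2 - t| + δ + |t - dist x z / 2| := by
    intro t h0 ht
    have h1 := hf.2.2 (dist x y / 2) ⟨by linarith, by linarith⟩ t ⟨h0, by linarith⟩
    have h2 := he.2.2 t ⟨h0, by linarith⟩ (dist x z / 2) ⟨by linarith, by linarith⟩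
    have h3 := hhyp.dist_le hgeo hf he h0 ht
    have h4 := dist_triangle4 (f (dist x y / 2)) (f t) (e t) (e (dist x z / 2))
    linarith
  -- The inner bound at `x` exceeds `dist x y / 2` in the first case and `dist x z / 2` in the
  -- second, so one midpoint can itself serve as crossing point. If `yz` is the longest side, the
  -- crossing is at the inner bound, and the total is `dist y z - (dist x y + dist x z) / 2 + δ`.
  rcases le_total (dist y z) (dist x z) with h | h
  · refine (key (dist x y / 2) (by linarith) (by linarith)).trans ?_
    have : |dist x y / 2 - dist x z / 2| ≤ L / 2 := abs_le.2 ⟨by linarith, by linarith⟩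
    simpa [add_comm] using this
  rcases le_total (dist y z) (dist x y) with h' | h'
  · refine (key (dist x z / 2) (by linarith) (by linarith)).trans ?_
    have : |dist x y / 2 - dist x z / 2| ≤ L / 2 := abs_le.2 ⟨by linarith, by linarith⟩
    simpa using this
  · refine (key _ (by linarith) le_rfl).trans ?_
    rw [abs_of_nonneg (by linarith), abs_of_nonpos (by linarith)]
    linarith

/-- Since `dist x z ≤ dist x y`, the inner bound at `y` is at least `dist y z / 2`. Hence `q` is
`δ`-close to the point of `[y, x]` at distance `dist y z / 2` from `y`, whose distance to `x` is
`dist x y - dist y z / 2 ≤ dist y z / 2`. -/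
theorem dist_vertex_le_aux {δ : ℝ} (hgeo : IsGeodesicSpace X) (hhyp : IsDeltaHyperbolic δ X)
    {q x y z : X} (hq : IsGeodesicMidpoint q y z) (hxy : dist x y ≤ dist y z)
    (h : dist x z ≤ dist x y) : dist x q ≤ dist y z / 2 + δ := by
  obtain ⟨g, hg, rfl⟩ := hq
  obtain ⟨f, hf⟩ := hgeo y x
  have ha := dist_nonneg (x := y) (y := z)
  have t1 := dist_triangle y x z
  rw [dist_comm y x] at t1
  have h1 := hhyp.dist_le hgeo hf hg (t := dist y z / 2) (by linarith)
    (by rw [dist_comm y x]; linarith)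
  have h2 := hf.2.2 (dist y x) ⟨dist_nonneg, le_rfl⟩ (dist y z / 2)
    ⟨by linarith, by rw [dist_comm y x]; linarith⟩
  rw [hf.2.1, dist_comm y x, abs_of_nonneg (by linarith)] at h2
  linarith [dist_triangle x (f (dist y z / 2)) (g (dist y z / 2))]

/-- The midpoint of the longest side of a triangle is close to the opposite vertex. -/
theorem dist_vertex_le {δ : ℝ} (hgeo : IsGeodesicSpace X) (hhyp : IsDeltaHyperbolic δ X)
    {q x y z : X} (hq : IsGeodesicMidpoint q y z) (hxy : dist x y ≤ dist y z)
    (hxz : dist x z ≤ dist y z) : dist x q ≤ dist y z / 2 + δ := by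
  rcases le_total (dist x z) (dist x y) with h | h
  · exact dist_vertex_le_aux hgeo hhyp hq hxy h
  · rw [dist_comm y z] at *
    exact dist_vertex_le_aux hgeo hhyp hq.symm hxz h

end IsGeodesicMidpoint

end Midpoints

noncomputable section

/-! ### Explicit chains -/

namespace SimplicialHomology

variable {k : Type v} [Field k] {X : Type u}

theorem boundary_single (n : ℕ) (x : Fin (n + 2) → X) :
    boundary k n (Finsupp.single x 1) =
      ∑ i : Fin (n + 2), Finsupp.single (x ∘ i.succAbove) ((-1 : k) ^ (i : ℕ)) := by
  simp [boundary]

variable (k X) in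
/-- The boundary of ordered triangles. -/
def triangleBoundary : ((Fin 3 → X) →₀ k) →ₗ[k] ((Fin 2 → X) →₀ k) :=
  boundary k 1

variable (k X) in
/-- The boundary of ordered tetrahedra. -/
def tetrahedronBoundary : ((Fin 4 → X) →₀ k) →ₗ[k] ((Fin 3 → X) →₀ k) :=
  boundary k 2

theorem triangleBoundary_single (x y z : X) :
    triangleBoundary k X (Finsupp.single ![x, y, z] 1) =
      Finsupp.single ![y, z] 1 - Finsupp.single ![x, z] 1 + Finsupp.single ![x, y] 1 := by
  have h0 : ![x, y, z] ∘ (0 : Fin 3).succAbove = ![y, z] := by ext i; fin_cases i <;> rfl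
  have h1 : ![x, y, z] ∘ (1 : Fin 3).succAbove = ![x, z] := by ext i; fin_cases i <;> rfl
  have h2 : ![x, y, z] ∘ (2 : Fin 3).succAbove = ![x, y] := by ext i; fin_cases i <;> rfl
  rw [triangleBoundary, boundary_single, Fin.sum_univ_three, h0, h1, h2]
  simp [sub_eq_add_neg]

theorem tetrahedronBoundary_single (x y z w : X) :
    tetrahedronBoundary k X (Finsupp.single ![x, y, z, w] 1) =
      Finsupp.single ![y, z, w] 1 - Finsupp.single ![x, z, w] 1 + Finsupp.single ![x, y, w] 1
        - Finsupp.single ![x, y, z] 1 := by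
  have h0 : ![x, y, z, w] ∘ (0 : Fin 4).succAbove = ![y, z, w] := by ext i; fin_cases i <;> rfl
  have h1 : ![x, y, z, w] ∘ (1 : Fin 4).succAbove = ![x, z, w] := by ext i; fin_cases i <;> rfl
  have h2 : ![x, y, z, w] ∘ (2 : Fin 4).succAbove = ![x, y, w] := by ext i; fin_cases i <;> rfl
  have h3 : ![x, y, z, w] ∘ (3 : Fin 4).succAbove = ![x, y, z] := by ext i; fin_cases i <;> rfl
  rw [tetrahedronBoundary, boundary_single, Fin.sum_univ_four, h0, h1, h2, h3]
  simp [sub_eq_add_neg, Odd.neg_one_pow (show Odd 3 by decide)]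

/-- To bound the chains of `K` by a submodule, it suffices to look at the simplices of `K`. -/
theorem chains_le_of_single {K : AbstractSimplicialComplex X} {n : ℕ}
    {S : Submodule k ((Fin (n + 1) → X) →₀ k)}
    (h : ∀ x : Fin (n + 1) → X, Finsupp.single x 1 ∈ chains k K n → Finsupp.single x 1 ∈ S) :
    chains k K n ≤ S := by
  classical
  unfold chains
  rw [Finsupp.supported_eq_span_single, Submodule.span_le]
  rintro _ ⟨x, hx, rfl⟩
  exact h x (Finsupp.single_mem_supported k 1 hx)

theorem single_mem_chains_ripsComplex [MetricSpace X] {a : ℝ} {n : ℕ} {x : Fin (n + 1) → X}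
    (h : ∀ i j, i < j → dist (x i) (x j) ≤ a) :
    Finsupp.single x (1 : k) ∈ chains k (ripsComplex X a) n := by
  classical
  unfold chains
  refine Finsupp.single_mem_supported k 1 ⟨by simp, ?_⟩
  intro p hp q hq hpq
  simp only [Finset.coe_image, Finset.coe_univ, Set.image_univ, Set.mem_range] at hp hq
  obtain ⟨i, rfl⟩ := hp
  obtain ⟨j, rfl⟩ := hq
  rcases lt_trichotomy i j with hij | rfl | hij
  · exact h i j hij
  · exact absurd rfl hpq
  · rw [dist_comm]
    exact h j i hij

theorem eq_or_dist_le_of_single_mem_chains [MetricSpace X] {a : ℝ} {n : ℕ}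
    {x : Fin (n + 1) → X} (h : Finsupp.single x (1 : k) ∈ chains k (ripsComplex X a) n)
    (i j : Fin (n + 1)) : x i = x j ∨ dist (x i) (x j) ≤ a := by
  classical
  have hx := (Finsupp.mem_supported k _).1 h (by simp : x ∈ _)
  by_cases hij : x i = x j
  · exact Or.inl hij
  · exact Or.inr (hx.2 (by simp) (by simp) hij)

theorem single_mem_chains_three [MetricSpace X] {a : ℝ} {x y z : X} (hxy : dist x y ≤ a)
    (hxz : dist x z ≤ a) (hyz : dist y z ≤ a) :
    Finsupp.single ![x, y, z] (1 : k) ∈ chains k (ripsComplex X a) 2 := by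
  refine single_mem_chains_ripsComplex fun i j hij => ?_
  fin_cases i <;> fin_cases j <;> first | assumption | exact absurd hij (by decide)

theorem single_mem_chains_four [MetricSpace X] {a : ℝ} {x y z w : X} (hxy : dist x y ≤ a)
    (hxz : dist x z ≤ a) (hxw : dist x w ≤ a) (hyz : dist y z ≤ a) (hyw : dist y w ≤ a)
    (hzw : dist z w ≤ a) :
    Finsupp.single ![x, y, z, w] (1 : k) ∈ chains k (ripsComplex X a) 3 := by
  refine single_mem_chains_ripsComplex fun i j hij => ?_
  fin_cases i <;> fin_cases j <;> first | assumption | exact absurd hij (by decide)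

/-! ### Midpoint subdivision -/

variable (k) in
/-- Subdivision of ordered triangles, with `m x y` as the new vertex on the edge `(x, y)`. -/
def subdivision (m : X → X → X) : ((Fin 3 → X) →₀ k) →ₗ[k] ((Fin 3 → X) →₀ k) :=
  Finsupp.linearCombination k fun x =>
    Finsupp.single ![x 0, m (x 0) (x 1), m (x 0) (x 2)] 1
      + Finsupp.single ![m (x 0) (x 1), x 1, m (x 1) (x 2)] 1
      + Finsupp.single ![m (x 0) (x 2), m (x 1) (x 2), x 2] 1
      -- Ordered chains have no relation `(u, v) = -(v, u)`; this order and sign make the inner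
      -- edges cancel literally.
      - Finsupp.single ![m (x 0) (x 1), m (x 0) (x 2), m (x 1) (x 2)] 1

variable (k) in
/-- The triangle between an edge and its subdivision. -/
def edgeHomotopy (m : X → X → X) : ((Fin 2 → X) →₀ k) →ₗ[k] ((Fin 3 → X) →₀ k) :=
  Finsupp.linearCombination k fun x => Finsupp.single ![x 0, m (x 0) (x 1), x 1] 1

theorem subdivision_single (m : X → X → X) (x y z : X) :
    subdivision k m (Finsupp.single ![x, y, z] 1) =
      Finsupp.single ![x, m x y, m x z] 1 + Finsupp.single ![m x y, y, m y z] 1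
        + Finsupp.single ![m x z, m y z, z] 1 - Finsupp.single ![m x y, m x z, m y z] 1 := by
  simp [subdivision]

theorem edgeHomotopy_single (m : X → X → X) (x y : X) :
    edgeHomotopy k m (Finsupp.single ![x, y] 1) = Finsupp.single ![x, m x y, y] 1 := by
  simp [edgeHomotopy]

theorem eq_vec_three (x : Fin 3 → X) : x = ![x 0, x 1, x 2] := by
  ext i; fin_cases i <;> rfl

/-- After the inner edges cancel, each edge `(x, y)` has become `(x, m x y) + (m x y, y)`, which
differs from it by the boundary of `(x, m x y, y)`. In particular, subdivision takes cycles to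
cycles. -/
theorem boundary_subdivision (m : X → X → X) :
    triangleBoundary k X ∘ₗ subdivision k m =
      triangleBoundary k X + triangleBoundary k X ∘ₗ edgeHomotopy k m ∘ₗ triangleBoundary k X := by
  refine Finsupp.lhom_ext' fun x => LinearMap.ext_ring ?_
  rw [eq_vec_three x]
  simp only [LinearMap.comp_apply, Finsupp.lsingle_apply, LinearMap.add_apply,
    subdivision_single, edgeHomotopy_single, triangleBoundary_single, map_add, map_sub]
  abel

section Rips

variable [MetricSpace X] {δ : ℝ} {m : X → X → X}

/-- The octahedron bounded by a triangle, its subdivision and the triangles over its edges is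
filled in `Rips(X, L)`, by the four tetrahedra around the diagonal that starts at the midpoint of
the longest side. -/
theorem subdivision_single_sub_mem_boundaries (hgeo : IsGeodesicSpace X)
    (hhyp : IsDeltaHyperbolic δ X) (hm : ∀ x y, IsGeodesicMidpoint (m x y) x y) {L : ℝ}
    (hL : 2 * δ ≤ L) {x y z : X} (hxy : dist x y ≤ L) (hxz : dist x z ≤ L)
    (hyz : dist y z ≤ L) :
    (subdivision k m - LinearMap.id - edgeHomotopy k m ∘ₗ triangleBoundary k X :
        ((Fin 3 → X) →₀ k) →ₗ[k] ((Fin 3 → X) →₀ k))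
      (Finsupp.single ![x, y, z] 1) ∈ boundaries k (ripsComplex X L) 2 := by
  have hL0 : 0 ≤ L := dist_nonneg.trans hxy
  have hp := hm x y
  have hq := hm y z
  have hr := hm x z
  simp only [LinearMap.sub_apply, LinearMap.comp_apply, LinearMap.id_apply, subdivision_single,
    triangleBoundary_single, map_add, map_sub, edgeHomotopy_single]
  generalize m x y = p at *
  generalize m y z = q at *
  generalize m x z = r at *
  have xp : dist x p ≤ L := by rw [hp.dist_left]; linarith
  have py : dist p y ≤ L := by rw [dist_comm, hp.dist_right]; linarith
  have yq : dist y q ≤ L := by rw [hq.dist_left]; linarith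
  have qz : dist q z ≤ L := by rw [dist_comm, hq.dist_right]; linarith
  have xr : dist x r ≤ L := by rw [hr.dist_left]; linarith
  have rz : dist r z ≤ L := by rw [dist_comm, hr.dist_right]; linarith
  -- Here `2 * δ ≤ L` enters, as `L / 2 + δ ≤ L`.
  have pr : dist p r ≤ L := by
    linarith [hp.dist_midpoint_le hgeo hhyp hr hxy hxz hyz]
  have pq : dist p q ≤ L := by
    linarith [hp.symm.dist_midpoint_le hgeo hhyp hq ((dist_comm y x).trans_le hxy) hyz hxz]
  have rq : dist r q ≤ L := by
    linarith [hr.symm.dist_midpoint_le hgeo hhyp hq.symm ((dist_comm z x).trans_le hxz)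
      ((dist_comm z y).trans_le hyz) hxy]
  change _ ∈ (chains k (ripsComplex X L) 3).map (tetrahedronBoundary k X)
  have longest : (dist x y ≤ dist y z ∧ dist x z ≤ dist y z) ∨
      (dist x y ≤ dist x z ∧ dist y z ≤ dist x z) ∨
      (dist x z ≤ dist x y ∧ dist y z ≤ dist x y) := by
    rcases le_total (dist x y) (dist y z) with h1 | h1 <;>
    rcases le_total (dist x y) (dist x z) with h2 | h2 <;>
    rcases le_total (dist x z) (dist y z) with h3 | h3 <;> grind
  -- The diagonals are `xq`, `yr` and `pz` respectively. All simplices are written in the vertex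
  -- order `x, p, y, r, q, z`, so common faces cancel literally.
  rcases longest with ⟨h1, h2⟩ | ⟨h1, h2⟩ | ⟨h1, h2⟩
  · have xq : dist x q ≤ L := by linarith [hq.dist_vertex_le hgeo hhyp h1 h2]
    refine ⟨Finsupp.single ![x, p, y, q] 1 - Finsupp.single ![x, y, q, z] 1
      + Finsupp.single ![x, r, q, z] 1 - Finsupp.single ![x, p, r, q] 1, ?_, ?_⟩
    · refine sub_mem (add_mem (sub_mem ?_ ?_) ?_) ?_ <;>
        apply single_mem_chains_four <;> assumption
    · simp only [map_add, map_sub, tetrahedronBoundary_single]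
      abel
  · have yr : dist y r ≤ L := by
      linarith [hr.dist_vertex_le hgeo hhyp ((dist_comm y x).trans_le h1) h2]
    refine ⟨Finsupp.single ![x, p, y, r] 1 - Finsupp.single ![x, y, r, z] 1
      + Finsupp.single ![y, r, q, z] 1 + Finsupp.single ![p, y, r, q] 1, ?_, ?_⟩
    · refine add_mem (add_mem (sub_mem ?_ ?_) ?_) ?_ <;>
        apply single_mem_chains_four <;> assumption
    · simp only [map_add, map_sub, tetrahedronBoundary_single]
      abel
  · have pz : dist p z ≤ L := by
      rw [dist_comm]
      linarith [hp.dist_vertex_le hgeo hhyp ((dist_comm z x).trans_le h1)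
        ((dist_comm z y).trans_le h2)]
    refine ⟨Finsupp.single ![x, p, y, z] 1 - Finsupp.single ![p, y, q, z] 1
      + Finsupp.single ![p, r, q, z] 1 - Finsupp.single ![x, p, r, z] 1, ?_, ?_⟩
    · refine sub_mem (add_mem (sub_mem ?_ ?_) ?_) ?_ <;>
        apply single_mem_chains_four <;> assumption
    · simp only [map_add, map_sub, tetrahedronBoundary_single]
      abel

/-- Each side of a small triangle is either half an old side or joins two midpoints. -/
theorem subdivision_single_mem_chains (hgeo : IsGeodesicSpace X)
    (hhyp : IsDeltaHyperbolic δ X) (hm : ∀ x y, IsGeodesicMidpoint (m x y) x y) {L : ℝ}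
    {x y z : X} (hxy : dist x y ≤ L) (hxz : dist x z ≤ L) (hyz : dist y z ≤ L) :
    subdivision k m (Finsupp.single ![x, y, z] 1) ∈ chains k (ripsComplex X (L / 2 + δ)) 2 := by
  have hδ := hhyp.nonneg hgeo x
  have hp := hm x y
  have hq := hm y z
  have hr := hm x z
  rw [subdivision_single]
  generalize m x y = p at *
  generalize m y z = q at *
  generalize m x z = r at *
  have xp : dist x p ≤ L / 2 + δ := by rw [hp.dist_left]; linarith
  have py : dist p y ≤ L / 2 + δ := by rw [dist_comm, hp.dist_right]; linarith
  have yq : dist y q ≤ L / 2 + δ := by rw [hq.dist_left]; linarith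
  have qz : dist q z ≤ L / 2 + δ := by rw [dist_comm, hq.dist_right]; linarith
  have xr : dist x r ≤ L / 2 + δ := by rw [hr.dist_left]; linarith
  have rz : dist r z ≤ L / 2 + δ := by rw [dist_comm, hr.dist_right]; linarith
  have pr := hp.dist_midpoint_le hgeo hhyp hr hxy hxz hyz
  have pq := hp.symm.dist_midpoint_le hgeo hhyp hq ((dist_comm y x).trans_le hxy) hyz hxz
  have rq := hr.symm.dist_midpoint_le hgeo hhyp hq.symm ((dist_comm z x).trans_le hxz)
    ((dist_comm z y).trans_le hyz) hxy
  refine sub_mem (add_mem (add_mem ?_ ?_) ?_) ?_ <;>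
    apply single_mem_chains_three <;> assumption

/-- Every `2`-cycle of `Rips(X, L)` is homologous to its subdivision in `Rips(X, L / 2 + δ)`. -/
theorem cycles_ripsComplex_le_half (hgeo : IsGeodesicSpace X) (hhyp : IsDeltaHyperbolic δ X)
    {L : ℝ} (hL : 2 * δ ≤ L) :
    cycles k (ripsComplex X L) 2 ≤
      cycles k (ripsComplex X (L / 2 + δ)) 2 ⊔ boundaries k (ripsComplex X L) 2 := by
  have : ∀ x y : X, ∃ p, IsGeodesicMidpoint p x y := fun x y => by
    obtain ⟨f, hf⟩ := hgeo x y
    exact ⟨_, f, hf, rfl⟩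
  choose m hm using this
  have hdist : ∀ x : Fin 3 → X, Finsupp.single x (1 : k) ∈ chains k (ripsComplex X L) 2 →
      ∀ i j, dist (x i) (x j) ≤ L := fun x hx i j => by
    -- Ordered simplices may repeat vertices; equal entries are covered by `0 ≤ 2 * δ ≤ L`.
    have hδ := hhyp.nonneg hgeo (x 0)
    rcases eq_or_dist_le_of_single_mem_chains (k := k) hx i j with h | h
    · rw [h, dist_self]
      linarith
    · exact h
  have h1 : chains k (ripsComplex X L) 2 ≤
      (chains k (ripsComplex X (L / 2 + δ)) 2).comap (subdivision k m) :=
    chains_le_of_single fun x hx => by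
      rw [eq_vec_three x, Submodule.mem_comap]
      exact subdivision_single_mem_chains hgeo hhyp hm (hdist x hx _ _) (hdist x hx _ _)
        (hdist x hx _ _)
  have h2 : chains k (ripsComplex X L) 2 ≤ (boundaries k (ripsComplex X L) 2).comap
      (subdivision k m - LinearMap.id - edgeHomotopy k m ∘ₗ triangleBoundary k X :
        ((Fin 3 → X) →₀ k) →ₗ[k] ((Fin 3 → X) →₀ k)) :=
    chains_le_of_single fun x hx => by
      rw [eq_vec_three x, Submodule.mem_comap]
      exact subdivision_single_sub_mem_boundaries hgeo hhyp hm hL (hdist x hx _ _)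
        (hdist x hx _ _) (hdist x hx _ _)
  rintro c ⟨hc, hc0⟩
  replace hc0 : triangleBoundary k X c = 0 := hc0
  have hs : subdivision k m c ∈ cycles k (ripsComplex X (L / 2 + δ)) 2 := by
    refine ⟨h1 hc, ?_⟩
    change triangleBoundary k X _ = 0
    have := LinearMap.congr_fun (boundary_subdivision (k := k) m) c
    simpa [hc0] using this
  have hb := h2 hc
  simp only [Submodule.mem_comap, LinearMap.sub_apply, LinearMap.id_apply,
    LinearMap.comp_apply, hc0, map_zero, sub_zero] at hb
  exact Submodule.mem_sup.2 ⟨_, hs, _, neg_mem hb, by abel⟩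

/-- Every `2`-cycle of a Rips complex is homologous to a cycle at any scale beyond `2δ`. -/
theorem cycles_ripsComplex_le (hgeo : IsGeodesicSpace X) (hhyp : IsDeltaHyperbolic δ X)
    {a : ℝ} (ha : 2 * δ < a) (b : ℝ) :
    cycles k (ripsComplex X b) 2 ≤
      cycles k (ripsComplex X a) 2 ⊔ boundaries k (ripsComplex X b) 2 := by
  -- The excess `b - 2 * δ` is halved by each subdivision; `n` bounds their number.
  have key : ∀ (n : ℕ) (b : ℝ), (b - 2 * δ) / 2 ^ n ≤ a - 2 * δ →
      cycles k (ripsComplex X b) 2 ≤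
        cycles k (ripsComplex X a) 2 ⊔ boundaries k (ripsComplex X b) 2 := by
    intro n
    induction n with
    | zero =>
      intro b hb
      exact (cycles_mono k (ripsComplex_faces_mono X (by simpa using hb)) 2).trans le_sup_left
    | succ n ih =>
      intro b hb
      rcases le_total b (2 * δ) with h | h
      · exact (cycles_mono k (ripsComplex_faces_mono X (by linarith)) 2).trans le_sup_left
      · refine (cycles_ripsComplex_le_half hgeo hhyp h).trans (sup_le ?_ le_sup_right)
        refine (ih (b / 2 + δ) (le_of_eq_of_le ?_ hb)).trans (sup_le_sup_left ?_ _)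
        · rw [pow_succ]
          field_simp
          ring
        · exact boundaries_mono k (ripsComplex_faces_mono X (by linarith)) 2
  obtain ⟨n, hn⟩ := pow_unbounded_of_one_lt ((b - 2 * δ) / (a - 2 * δ)) one_lt_two
  refine key n b ?_
  rw [div_lt_iff₀ (by linarith)] at hn
  rw [div_le_iff₀ (by positivity)]
  linarith

end Rips

/-! ### Cones -/

variable (k) in
/-- The cone `(x₀, …, xₙ) ↦ (p, x₀, …, xₙ)` with apex `p`. -/
def cone (p : X) (n : ℕ) : ((Fin n → X) →₀ k) →ₗ[k] ((Fin (n + 1) → X) →₀ k) :=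
  Finsupp.lmapDomain k k fun x : Fin n → X => (Fin.cons p x : Fin (n + 1) → X)

/-- Deleting the apex returns the simplex; deleting a later entry commutes with coning, with one
extra sign. -/
theorem boundary_cone (p : X) (n : ℕ) (c : (Fin (n + 2) → X) →₀ k) :
    boundary k (n + 1) (cone k p (n + 2) c) = c - cone k p (n + 1) (boundary k n c) := by
  suffices boundary k (n + 1) ∘ₗ cone k p (n + 2) =
      LinearMap.id - cone k p (n + 1) ∘ₗ boundary k n from LinearMap.congr_fun this c
  refine Finsupp.lhom_ext' fun x => LinearMap.ext_ring ?_
  have h0 : (Fin.cons p x : Fin (n + 3) → X) ∘ (0 : Fin (n + 3)).succAbove = x := by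
    ext j; simp
  have h1 : ∀ i : Fin (n + 2), (Fin.cons p x : Fin (n + 3) → X) ∘ i.succ.succAbove =
      Fin.cons p (x ∘ i.succAbove) := fun i => by
    ext j
    refine Fin.cases ?_ (fun j => ?_) j <;> simp
  simp only [LinearMap.comp_apply, Finsupp.lsingle_apply, LinearMap.sub_apply,
    LinearMap.id_apply, cone, Finsupp.lmapDomain_apply, Finsupp.mapDomain_single,
    boundary_single, Fin.sum_univ_succ (n := n + 2), h0, h1, Finsupp.mapDomain_finsetSum]
  simp [pow_succ, sub_eq_add_neg]

end SimplicialHomology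
end

/-! ### Rips cycles at negative and at large scales. -/

noncomputable section

namespace SimplicialHomology

variable {k : Type v} [Field k] {X : Type u}

/-- A cycle supported on constant triples vanishes. -/
theorem cycles_ripsComplex_eq_bot [MetricSpace X] {a : ℝ} (ha : a < 0) :
    cycles k (ripsComplex X a) 2 = ⊥ := by
  rw [eq_bot_iff]
  rintro c ⟨hc, hc0⟩
  -- The boundary of `(x, x, x)` is `(x, x)`, so `s` inverts the boundary on constant triples.
  let s : ((Fin 2 → X) →₀ k) →ₗ[k] ((Fin 3 → X) →₀ k) :=
    Finsupp.lmapDomain k k fun x => ![x 0, x 0, x 1]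
  have h : chains k (ripsComplex X a) 2 ≤
      LinearMap.ker (s ∘ₗ triangleBoundary k X - LinearMap.id) :=
    chains_le_of_single fun x hx => by
      have hx' : ∀ i j, x i = x j := fun i j =>
        (eq_or_dist_le_of_single_mem_chains (k := k) hx i j).resolve_right
          fun h => absurd (dist_nonneg.trans h) ha.not_ge
      rw [eq_vec_three x, hx' 1 0, hx' 2 0, LinearMap.mem_ker]
      simp [s, triangleBoundary_single, Finsupp.mapDomain_single]
  have h1 := h hc
  rw [LinearMap.mem_ker, LinearMap.sub_apply, LinearMap.comp_apply,
    show triangleBoundary k X c = 0 from hc0, map_zero, zero_sub, neg_eq_zero] at h1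
  exact h1

/-- Every cycle of positive degree bounds at all sufficiently large scales. -/
theorem exists_mem_boundaries_ripsComplex [MetricSpace X] {n : ℕ}
    (c : (Fin (n + 2) → X) →₀ k) (hc : boundary k n c = 0) :
    ∃ a : ℝ, ∀ b, a ≤ b → c ∈ boundaries k (ripsComplex X b) (n + 1) := by
  classical
  rcases isEmpty_or_nonempty X with hX | ⟨⟨p⟩⟩
  · exact ⟨0, fun b _ => by
      rw [Subsingleton.elim c 0]
      exact zero_mem _⟩
  -- All vertices of the cone lie in the finite set `F`, so a bound on its pairwise distances is a
  -- sufficient scale.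
  let F : Finset X := insert p (c.support.biUnion fun x => Finset.univ.image x)
  obtain ⟨a, ha⟩ := ((F ×ˢ F).image fun q => dist q.1 q.2).exists_le
  have hF : ∀ x ∈ F, ∀ y ∈ F, dist x y ≤ a := fun x hx y hy =>
    ha _ (Finset.mem_image.2 ⟨(x, y), Finset.mem_product.2 ⟨hx, hy⟩, rfl⟩)
  refine ⟨a, fun b hb => ⟨cone k p (n + 2) c, ?_, ?_⟩⟩
  · have hcone : cone k p (n + 2) c =
        ∑ x ∈ c.support, c x • Finsupp.single (Fin.cons p x : Fin (n + 3) → X) 1 := by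
      simp [cone, Finsupp.mapDomain, Finsupp.sum]
    rw [hcone]
    refine sum_mem fun x hx => Submodule.smul_mem _ _ ?_
    have hmem : ∀ i, (Fin.cons p x : Fin (n + 3) → X) i ∈ F := by
      refine Fin.cases (by simp [F]) fun i => ?_
      rw [Fin.cons_succ]
      exact Finset.mem_insert_of_mem (Finset.mem_biUnion.2 ⟨x, hx, by simp⟩)
    exact single_mem_chains_ripsComplex fun i j _ => (hF _ (hmem i) _ (hmem j)).trans hb
  · rw [boundary_cone, hc, map_zero, sub_zero]

end SimplicialHomology

/-! ### Vanishing of the persistence measure -/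

namespace PersistenceModule

variable {k : Type v} [Field k] (V : PersistenceModule.{v, w} k)

theorem map_map_apply {a b c : ℝ} (hab : a ≤ b) (hbc : b ≤ c) (x : V.obj a) :
    V.map hbc (V.map hab x) = V.map (hab.trans hbc) x :=
  LinearMap.congr_fun (V.map_comp hab hbc) x

theorem imageAt_coe {a c : ℝ} (h : a ≤ c) : V.imageAt a c = LinearMap.range (V.map h) := by
  refine le_antisymm (iSup_le fun x => iSup_le fun hx => iSup_le fun _ => ?_) ?_
  · obtain rfl := EReal.coe_eq_coe_iff.1 hx
    exact le_rfl
  · exact le_iSup_of_le a (le_iSup_of_le rfl (le_iSup_of_le h le_rfl))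

theorem kernelAt_top (c : ℝ) : V.kernelAt c ⊤ = ⊤ := by
  simp [kernelAt]

theorem map_imageAt_le (a : EReal) {c c' : ℝ} (h : c ≤ c') :
    (V.imageAt a c).map (V.map h) ≤ V.imageAt a c' := by
  rw [Submodule.map_le_iff_le_comap]
  refine iSup_le fun x => iSup_le fun hx => iSup_le fun hxc => ?_
  rintro _ ⟨y, rfl⟩
  subst hx
  rw [Submodule.mem_comap, V.map_map_apply, V.imageAt_coe (hxc.trans h)]
  exact ⟨y, rfl⟩

/-- Intersecting both images with the same kernel preserves the inclusion, so the kernel plays no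
role. -/
theorem measure_eq_zero {R : HalfPlaneRect} (h : V.imageAt R.b R.c ≤ V.imageAt R.a R.c) :
    V.measure R = 0 := by
  have : Subsingleton (Subquotient (V.imageAt R.b R.c ⊓ V.kernelAt R.c R.d)
      (V.imageAt R.a R.c ⊓ V.kernelAt R.c R.d)) := by
    refine subsingleton_of_forall_eq 0 fun y => ?_
    obtain ⟨z, rfl⟩ := Subquotient.mk_surjective _ _ y
    exact (Subquotient.mk_eq_zero z).2 (inf_le_inf_right _ h z.2)
  unfold measure
  rw [rank_subsingleton']
  exact map_zero _

theorem measure_eq_zero_of_surjective {R : HalfPlaneRect} {a : ℝ} (ha : R.a = a)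
    (h : ∀ hab : a ≤ R.b, Function.Surjective (V.map hab)) : V.measure R = 0 := by
  have hab : a ≤ R.b := by
    have := R.a_lt_b
    rw [ha] at this
    exact (EReal.coe_lt_coe_iff.1 this).le
  apply V.measure_eq_zero
  rw [ha, V.imageAt_coe R.b_le_c, V.imageAt_coe (hab.trans R.b_le_c)]
  rintro _ ⟨y, rfl⟩
  obtain ⟨x, rfl⟩ := h hab y
  exact ⟨x, (V.map_map_apply hab R.b_le_c x).symm⟩

theorem measure_eq_zero_of_subsingleton {R : HalfPlaneRect} (h : Subsingleton (V.obj R.b)) :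
    V.measure R = 0 := by
  apply V.measure_eq_zero
  rw [V.imageAt_coe R.b_le_c]
  rintro _ ⟨y, rfl⟩
  rw [Subsingleton.elim y 0, map_zero]
  exact zero_mem _

/-- If every element of `V` eventually dies, then a rectangle of finite measure that is unbounded
above contains such a rectangle of measure zero. -/
theorem exists_measure_eq_zero_of_top
    (hV : ∀ (c : ℝ) (z : V.obj c), ∃ c₀, ∀ c' (h : c ≤ c'), c₀ ≤ c' → V.map h z = 0)
    {R : HalfPlaneRect} (hd : R.d = ⊤) (hR : V.measure R < ⊤) :
    ∃ c', ∃ h : R.c ≤ c',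
      V.measure ⟨R.a, R.b, c', ⊤, R.a_lt_b, R.b_le_c.trans h, EReal.coe_lt_top _⟩ = 0 := by
  classical
  rw [measure, Cardinal.toENat_lt_top, hd, V.kernelAt_top, inf_top_eq, inf_top_eq] at hR
  have : Module.Finite k (Subquotient (V.imageAt R.b R.c) (V.imageAt R.a R.c)) :=
    Module.rank_lt_aleph0_iff.1 hR
  obtain ⟨S, hS⟩ := Module.Finite.fg_top (R := k)
    (M := Subquotient (V.imageAt R.b R.c) (V.imageAt R.a R.c))
  choose z hz using Subquotient.mk_surjective (V.imageAt R.b R.c) (V.imageAt R.a R.c)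
  choose c₀ hc₀ using hV R.c
  -- Beyond `c'`, representatives of the finitely many generators modulo `im V_a` are all dead.
  obtain ⟨c', hc'⟩ := (insert R.c (S.image fun y => c₀ (z y))).exists_le
  have h : R.c ≤ c' := hc' _ (Finset.mem_insert_self _ _)
  refine ⟨c', h, V.measure_eq_zero ?_⟩
  change V.imageAt R.b c' ≤ V.imageAt R.a c'
  have key : V.imageAt R.b R.c ≤ (V.imageAt R.a c').comap (V.map h) := by
    intro x hx
    have hspan : ∀ y ∈ Submodule.span k (S : Set (Subquotient (V.imageAt R.b R.c)
        (V.imageAt R.a R.c))), ∀ w, Subquotient.mk _ _ w = y →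
          V.map h (w : V.obj R.c) ∈ V.imageAt R.a c' := by
      -- The property depends only on the class, because structure maps carry the image of `V_a`
      -- into the image of `V_a`.
      have hdiff : ∀ w w' : V.imageAt R.b R.c,
          Subquotient.mk _ (V.imageAt R.a R.c) w = Subquotient.mk _ _ w' →
          V.map h (w' : V.obj R.c) ∈ V.imageAt R.a c' →
          V.map h (w : V.obj R.c) ∈ V.imageAt R.a c' := by
        intro w w' hw hw'
        have h1 := (Subquotient.mk_eq_zero (w - w')).1 (by rw [map_sub, hw, sub_self])
        have h2 := add_mem (V.map_imageAt_le R.a h (Submodule.mem_map_of_mem h1)) hw'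
        simpa using h2
      intro y hy
      induction hy using Submodule.span_induction with
      | mem y hy =>
        intro w hw
        refine hdiff w (z y) (by rw [hw, hz]) ?_
        rw [hc₀ _ c' h (hc' _ (Finset.mem_insert_of_mem (Finset.mem_image_of_mem _ hy)))]
        exact zero_mem _
      | zero => exact fun w hw => hdiff w 0 (by rw [hw, map_zero]) (by simp)
      | add y y' _ _ ih ih' =>
        intro w hw
        refine hdiff w (z y + z y') (by rw [hw, map_add, hz, hz]) ?_
        simpa using add_mem (ih _ (hz y)) (ih' _ (hz y'))
      | smul r y _ ih =>
        intro w hw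
        refine hdiff w (r • z y) (by rw [hw, map_smul, hz]) ?_
        simpa using Submodule.smul_mem _ r (ih _ (hz y))
    exact hspan _ (hS ▸ Submodule.mem_top) ⟨x, hx⟩ rfl
  rw [V.imageAt_coe (R.b_le_c.trans h)]
  rintro _ ⟨y, rfl⟩
  rw [← V.map_map_apply R.b_le_c h]
  exact key (by rw [V.imageAt_coe R.b_le_c]; exact ⟨y, rfl⟩)

theorem diagram_eq_zero_of_measure_eq_zero {P : DecoratedPoint} {R : HalfPlaneRect}
    (hP : P.MemRect R) (hR : V.measure R = 0) : V.diagram P = 0 := by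
  have : (⨅ (R : HalfPlaneRect) (_ : P.MemRect R), V.measure R) = 0 :=
    le_antisymm (hR ▸ iInf₂_le R hP) zero_le
  rw [diagram, this]
  rfl

theorem mem_finiteInterior_of_diagram_ne_zero {P : DecoratedPoint} (h : V.diagram P ≠ 0) :
    P ∈ V.finiteInterior := by
  by_contra hP
  refine h ?_
  have : (⨅ (R : HalfPlaneRect) (_ : P.MemRect R), V.measure R) = ⊤ :=
    iInf₂_eq_top.2 fun R hR => not_lt_top_iff.1 fun hlt => hP ⟨R, hR, hlt⟩
  rw [diagram, this]
  rfl

variable {V} in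
theorem IsDiagram.eq_zero_of_measure_eq_zero {D : DecoratedPoint → ℕ} (hD : V.IsDiagram D)
    {P : DecoratedPoint} {R : HalfPlaneRect} (hP : P.MemRect R) (hR : V.measure R = 0) :
    D P = 0 := by
  have h := hD.2 R (by rw [hR]; exact ENat.natCast_lt_top 0)
  rw [hR, ENat.card_eq_zero_iff_empty] at h
  by_contra h0
  exact h.false ⟨⟨P, hP⟩, ⟨0, Nat.pos_of_ne_zero h0⟩⟩

end PersistenceModule

/-! ### Locating the diagram of second Rips homology. -/

section RipsHomology

variable {k : Type v} [Field k] {X : Type u} [MetricSpace X] {δ : ℝ}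

open SimplicialHomology

theorem ripsHomology_map_surjective (hgeo : IsGeodesicSpace X) (hhyp : IsDeltaHyperbolic δ X)
    {a b : ℝ} (ha : 2 * δ < a) (hab : a ≤ b) :
    Function.Surjective ((ripsHomology k X 2).map hab) := by
  intro y
  obtain ⟨⟨c, hc⟩, rfl⟩ := Subquotient.mk_surjective _ _ y
  obtain ⟨c', hc', e, he, rfl⟩ :=
    Submodule.mem_sup.1 (cycles_ripsComplex_le hgeo hhyp ha b hc)
  refine ⟨Subquotient.mk _ _ ⟨c', hc'⟩, ?_⟩
  change Subquotient.mk _ _ _ = _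
  rw [← sub_eq_zero, ← map_sub, Subquotient.mk_eq_zero]
  simpa using he

theorem subsingleton_ripsHomology_of_neg {a : ℝ} (ha : a < 0) :
    Subsingleton ((ripsHomology k X 2).obj a) := by
  refine subsingleton_of_forall_eq 0 fun y => ?_
  obtain ⟨⟨c, hc⟩, rfl⟩ := Subquotient.mk_surjective _ _ y
  refine (Subquotient.mk_eq_zero _).2 ?_
  obtain rfl : c = 0 := by rwa [cycles_ripsComplex_eq_bot ha, Submodule.mem_bot] at hc
  exact zero_mem _

theorem subsingleton_ripsHomology_of_isEmpty [IsEmpty X] (a : ℝ) :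
    Subsingleton ((ripsHomology k X 2).obj a) := by
  refine subsingleton_of_forall_eq 0 fun y => ?_
  obtain ⟨c, rfl⟩ := Subquotient.mk_surjective _ _ y
  rw [Subsingleton.elim c 0]
  exact map_zero (Subquotient.mk _ _)

theorem ripsHomology_eventually_zero (c : ℝ) (z : (ripsHomology k X 2).obj c) :
    ∃ c₀, ∀ c' (h : c ≤ c'), c₀ ≤ c' → (ripsHomology k X 2).map h z = 0 := by
  obtain ⟨⟨ζ, hζ⟩, rfl⟩ := Subquotient.mk_surjective _ _ z
  obtain ⟨c₀, hc₀⟩ := exists_mem_boundaries_ripsComplex ζ hζ.2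
  refine ⟨c₀, fun c' h hc' => ?_⟩
  change Subquotient.mk _ _ _ = 0
  rw [Subquotient.mk_eq_zero]
  exact hc₀ c' hc'

theorem ripsHomology_measure_eq_zero_of_lt (hgeo : IsGeodesicSpace X)
    (hhyp : IsDeltaHyperbolic δ X) {R : HalfPlaneRect} (h : ((2 * δ : ℝ) : EReal) < R.a) :
    (ripsHomology k X 2).measure R = 0 := by
  lift R.a to ℝ using ⟨R.a_lt_b.ne_top, h.ne_bot⟩ with a ha
  exact PersistenceModule.measure_eq_zero_of_surjective _ ha.symm fun hab =>
    ripsHomology_map_surjective hgeo hhyp (EReal.coe_lt_coe_iff.1 h) hab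

/-- A decorated point of the finite interior outside the strip lies in a rectangle of measure
zero. -/
theorem exists_ripsHomology_measure_eq_zero (hgeo : IsGeodesicSpace X)
    (hhyp : IsDeltaHyperbolic δ X) {P : DecoratedPoint}
    (hP : P ∈ (ripsHomology k X 2).finiteInterior) (hS : P.toPoint ∉ verticalStrip δ) :
    ∃ R : HalfPlaneRect, P.MemRect R ∧ (ripsHomology k X 2).measure R = 0 := by
  obtain ⟨R, ⟨hb, hd⟩, hR⟩ := hP
  obtain ⟨⟨p, sp⟩, ⟨q, sq⟩⟩ := P
  simp only [DecoratedNumber.MemIcc, DecoratedPoint.toPoint, verticalStrip,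
    DecoratedPoint.MemRect] at *
  have hpb : p ≤ R.b := by
    rcases hb with h | h
    · exact h.2.2.le
    · exact h.2.2
  have hcq : (R.c : EReal) ≤ q := by
    rcases hd with h | h
    · exact h.2.1
    · exact h.2.1.le
  -- Birth before `0`: pull the right side of the rectangle to some `b' < 0`. A point `p⁺` needs `p
  -- < b'`, while for `p⁻` the choice `b' = p` is allowed.
  rcases lt_or_ge p 0 with hp0 | hp0
  · obtain ⟨b', hb'0, hb'R, hb'⟩ : ∃ b' : ℝ, b' < 0 ∧ b' ≤ R.b ∧
        ((sp = true ∧ R.a ≤ p ∧ p < b') ∨ (¬ sp = true ∧ R.a < p ∧ p ≤ b')) := by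
      rcases hb with ⟨h1, h2, h3⟩ | ⟨h1, h2, h3⟩
      · obtain ⟨t, ht1, ht2⟩ := EReal.lt_iff_exists_real_btwn.1 (lt_min hp0 h3)
        rw [lt_min_iff] at ht2
        exact ⟨t, by exact_mod_cast ht2.1, by exact_mod_cast ht2.2.le, Or.inl ⟨h1, h2, ht1⟩⟩
      · lift p to ℝ using ⟨hp0.ne_top, h2.ne_bot⟩
        exact ⟨p, by exact_mod_cast hp0, by exact_mod_cast h3, Or.inr ⟨h1, h2, le_rfl⟩⟩
    have hab : R.a < b' := by
      rcases hb' with h | h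
      · exact h.2.1.trans_lt h.2.2
      · exact h.2.1.trans_le h.2.2
    exact ⟨⟨R.a, b', R.c, R.d, hab, hb'R.trans R.b_le_c, R.c_lt_d⟩, ⟨hb', hd⟩,
      PersistenceModule.measure_eq_zero_of_subsingleton _
        (subsingleton_ripsHomology_of_neg hb'0)⟩
  -- Birth after `2 * δ`: push the left side beyond `2 * δ`, to `p` itself for `p⁺` and strictly
  -- below `p` for `p⁻`.
  rcases lt_or_ge ((2 * δ : ℝ) : EReal) p with hp | hp
  · obtain ⟨a', ha'δ, ha'⟩ : ∃ a' : EReal, ((2 * δ : ℝ) : EReal) < a' ∧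
        ((sp = true ∧ a' ≤ p ∧ p < R.b) ∨ (¬ sp = true ∧ a' < p ∧ p ≤ R.b)) := by
      rcases hb with ⟨h1, h2, h3⟩ | ⟨h1, h2, h3⟩
      · exact ⟨p, hp, Or.inl ⟨h1, le_rfl, h3⟩⟩
      · obtain ⟨t, ht1, ht2⟩ := exists_between hp
        exact ⟨t, ht1, Or.inr ⟨h1, ht2, h3⟩⟩
    have hab : a' < R.b := by
      rcases ha' with h | h
      · exact h.2.1.trans_lt h.2.2
      · exact h.2.1.trans_le h.2.2
    exact ⟨⟨a', R.b, R.c, R.d, hab, R.b_le_c, R.c_lt_d⟩, ⟨ha', hd⟩,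
      ripsHomology_measure_eq_zero_of_lt hgeo hhyp ha'δ⟩
  -- Only death at `+∞` remains. Its decoration must be `-`, and raising the lower side of the
  -- rectangle keeps the point inside.
  have hq0 : 0 ≤ q := hp0.trans (hpb.trans ((EReal.coe_le_coe_iff.2 R.b_le_c).trans hcq))
  have hq : q = ⊤ := not_lt_top_iff.1 fun h => hS ⟨⟨hp0, hp⟩, hq0, h⟩
  subst hq
  rcases hd with h | h
  · exact absurd h.2.2 not_top_lt
  · obtain ⟨c', hc, h0⟩ := PersistenceModule.exists_measure_eq_zero_of_top _
      ripsHomology_eventually_zero (top_le_iff.1 h.2.2) hR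
    exact ⟨⟨R.a, R.b, c', ⊤, R.a_lt_b, R.b_le_c.trans hc, EReal.coe_lt_top _⟩,
      ⟨hb, Or.inr ⟨h.1, EReal.coe_lt_top _, le_rfl⟩⟩, h0⟩

/-- A rectangle disjoint from the strip has measure zero. -/
theorem ripsHomology_measure_eq_zero_of_disjoint (hgeo : IsGeodesicSpace X)
    (hhyp : IsDeltaHyperbolic δ X) {R : HalfPlaneRect}
    (hR : Disjoint R.toSet (verticalStrip δ)) : (ripsHomology k X 2).measure R = 0 := by
  -- For empty `X` the hypotheses allow `δ < 0`, and then the strip is empty.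
  rcases isEmpty_or_nonempty X with hX | ⟨⟨x⟩⟩
  · exact PersistenceModule.measure_eq_zero_of_subsingleton _
      (subsingleton_ripsHomology_of_isEmpty _)
  have hδ : (0 : EReal) ≤ ((2 * δ : ℝ) : EReal) := by
    have := hhyp.nonneg hgeo x
    exact_mod_cast (by linarith : 0 ≤ 2 * δ)
  rcases lt_or_ge R.b 0 with hb | hb
  · exact PersistenceModule.measure_eq_zero_of_subsingleton _
      (subsingleton_ripsHomology_of_neg hb)
  rcases lt_or_ge ((2 * δ : ℝ) : EReal) R.a with ha | ha
  · exact ripsHomology_measure_eq_zero_of_lt hgeo hhyp ha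
  -- In the remaining case `(max 0 R.a, R.c)` lies in both the rectangle and the strip.
  refine absurd hR (Set.not_disjoint_iff.2 ⟨(max 0 R.a, R.c), ⟨⟨le_max_right _ _, ?_⟩,
    le_rfl, R.c_lt_d.le⟩, ⟨le_max_left _ _, max_le hδ ha⟩, ?_, EReal.coe_lt_top _⟩)
  · exact max_le (by exact_mod_cast hb) R.a_lt_b.le
  · exact EReal.coe_nonneg.2 (hb.trans R.b_le_c)

end RipsHomology
end

theorem mainTheorem10 (k : Type v) [Field k] (X : Type u) [MetricSpace X] (δ : ℝ)
    (hgeo : IsGeodesicSpace X) (hhyp : IsDeltaHyperbolic δ X) :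
    (∀ R : HalfPlaneRect, Disjoint R.toSet (verticalStrip δ) →
      (ripsHomology k X 2).measure R = 0) ∧
    (∀ P : DecoratedPoint, (ripsHomology k X 2).diagram P ≠ 0 → P.toPoint ∈ verticalStrip δ) ∧
    (∀ D : DecoratedPoint → ℕ, (ripsHomology k X 2).IsDiagram D →
      ∀ P : DecoratedPoint, D P ≠ 0 → P.toPoint ∈ verticalStrip δ) := by
  refine ⟨fun R hR => ripsHomology_measure_eq_zero_of_disjoint hgeo hhyp hR, fun P hP => ?_,
    fun D hD P hP => ?_⟩
  · by_contra hS
    obtain ⟨R, hPR, hR⟩ := exists_ripsHomology_measure_eq_zero hgeo hhyp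
      ((ripsHomology k X 2).mem_finiteInterior_of_diagram_ne_zero hP) hS
    exact hP ((ripsHomology k X 2).diagram_eq_zero_of_measure_eq_zero hPR hR)
  · by_contra hS
    obtain ⟨R, hPR, hR⟩ := exists_ripsHomology_measure_eq_zero hgeo hhyp (hD.1 P hP) hS
    exact hP (hD.eq_zero_of_measure_eq_zero hPR hR)
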